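/- Let $F$ be a non-archimedean local field of characteristic zero with ring of integers $\mathcal{O}$, uniformizer $\varpi$ and residue field of order $q$. Let $G=\mathrm{PGL}(3,F)$ and $K=\mathrm{PGL}(3,\mathcal{O})$. Let $\mathcal{B}$ be the Bruhat–Tits building of $G$, whose set of vertices is $G/K$, with its $G$-invariant metric $d(\cdot,\cdot)$, Euclidean on each apartment and normalized so that adjacent vertices have distance $1$. For a torsion-free lattice $\Gamma<G$ put $Y=\Gamma\backslash G/K$ (with counting measure) and $\hat Y=\Gamma\backslash\mathcal{B}$. For $y\in Y$ let $\mathrm{InjRad}_Y(y)$ be the supremum of all $r\ge 0$ such that the ball of radius $r$ in $\mathcal{B}$ centered at a lift of $y$ maps injectively to $\hat Y$, and let $\mathrm{InjRad}(Y)=\inf_{y\in Y}\mathrm{InjRad}_Y(y)$. There exist constants $C_1,C_2>0$ (independent of $R$, $\Gamma$, $D$ and $\mathcal{K}$ below) such that the following holds. Let $\Gamma<G$ be a torsion-free lattice, let $D\subset G/K$ be a fundamental domain for the action of $\Gamma$ on $G/K$ (a set containing exactly one point of each orbit), let $\mathcal{K}:G/K\times G/K\to\mathbb{C}$ satisfy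 $\mathcal{K}(\gamma z,\gamma w)=\mathcal{K}(z,w)$ for all $\gamma\in\Gamma$, and let $R\ge 0$ be such that $\mathcal{K}(z,w)=0$ whenever $d(z,w)\ge R$. Then $\bar{\mathcal{K}}_Y(\Gamma z,\Gamma w)=\sum_{\gamma\in\Gamma}\mathcal{K}(z,\gamma w)$ is a well-defined function on $Y\times Y$, it is the kernel function of a bounded operator $\bar{\mathcal{K}}^{\mathrm{Op}}_Y$ on $L^2(Y)$, and $$\|\bar{\mathcal{K}}^{\mathrm{Op}}_Y\|_{\mathrm{HS}}^2\;\le\;\sum_{z\in D}\sum_{w\in G/K}|\mathcal{K}(z,w)|^2\;+\;\frac{C_1q^{C_2R}}{\mathrm{InjRad}(Y)^2}\,\|\mathcal{K}\|_\infty^2\;\#\{y\in Y:\mathrm{InjRad}_Y(y)\le R\},$$ where $\|U\|_{\mathrm{HS}}^2=\sum_j\|Ue_j\|^2$ for any orthonormal basis $(e_j)$. -/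

import Mathlib

open scoped ENNReal NNReal MatrixGroups ValuativeRel

noncomputable section

namespace Kernel7

section Group

variable (F : Type*) [Field F]

/-- `G = PGL(3, F)`. -/
abbrev G : Type _ := Matrix.ProjGenLinGroup (Fin 3) F

/-- The quotient topology on `PGL(3, F) = GL(3, F) / center`. -/
instance instTopologicalSpaceG [TopologicalSpace F] : TopologicalSpace (G F) :=
  TopologicalSpace.coinduced
    (Matrix.ProjGenLinGroup.mk : GL (Fin 3) F →* G F) inferInstance

/-- The Borel `σ`-algebra of `PGL(3, F)`. -/
instance instMeasurableSpaceG [TopologicalSpace F] : MeasurableSpace (G F) := borel _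

variable [ValuativeRel F]

/-- `K`, the image of `GL(3, 𝒪)` in `PGL(3, F)`; this is `PGL(3, 𝒪)`. -/
def maxCompact : Subgroup (G F) :=
  ((Matrix.ProjGenLinGroup.mk : GL (Fin 3) F →* G F).comp
    (Matrix.GeneralLinearGroup.map (algebraMap 𝒪[F] F))).range

/-- `G / K`, the set of vertices of the building. -/
abbrev Vertex : Type _ := G F ⧸ maxCompact F

end Group

section Lattice

variable {F : Type*} [Field F] [TopologicalSpace F]

/-- A lattice in `G`: a discrete subgroup of finite covolume. -/
def IsLatticeIn (Γ : Subgroup (G F)) : Prop :=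
  DiscreteTopology Γ ∧
    ∃ μ : MeasureTheory.Measure (G F), μ.IsHaarMeasure ∧
      ∃ s : Set (G F), MeasureTheory.IsFundamentalDomain Γ s μ ∧ μ s < ∞

/-- No nontrivial element of finite order. -/
def IsTorsionFreeSubgroup (Γ : Subgroup (G F)) : Prop :=
  ∀ γ ∈ Γ, IsOfFinOrder γ → γ = 1

end Lattice

section Building

variable {F : Type*} [Field F]

/-- The diagonal element `ϖ^l = diag(ϖ^l₁, ϖ^l₂, ϖ^l₃)` of `G`. -/
def diagPow (ϖ : Fˣ) (l : Fin 3 → ℤ) : G F :=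
  Matrix.ProjGenLinGroup.mk
    (Units.map (Matrix.diagonalRingHom (Fin 3) F).toMonoidHom
      (MulEquiv.piUnits.symm fun i => ϖ ^ l i))

variable [ValuativeRel F]

/-- `ϖ` is a uniformizer of `𝒪`. -/
def IsUniformizer (ϖ : Fˣ) : Prop :=
  ∃ p : 𝒪[F], Irreducible p ∧ (p : F) = ϖ

/-- The vertices of the standard chamber: the classes of the lattices
`𝒪³ ⊃ diag(ϖ,1,1)𝒪³ ⊃ diag(ϖ,ϖ,1)𝒪³ ⊃ ϖ𝒪³`. -/
def stdChamber (ϖ : Fˣ) : Set (Vertex F) :=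
  {(diagPow ϖ ![0, 0, 0] : Vertex F), (diagPow ϖ ![1, 0, 0] : Vertex F),
    (diagPow ϖ ![1, 1, 0] : Vertex F)}

/-- The chambers (2-simplices) of the building are the `G`-translates of the standard chamber;
a set of vertices spans a simplex if it is nonempty and contained in a chamber. -/
def IsSimplex (ϖ : Fˣ) (S : Set (Vertex F)) : Prop :=
  S.Nonempty ∧ ∃ g : G F, S ⊆ (fun v => g • v) '' stdChamber ϖ

/-- The geometric realization of the Bruhat–Tits building of `PGL(3, F)`: its points are the
formal convex combinations (barycentric coordinates) of the vertices of a simplex. -/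
@[ext]
structure Building (ϖ : Fˣ) where
  wt : Vertex F →₀ ℝ
  nonneg : ∀ v, 0 ≤ wt v
  sum_eq_one : (wt.sum fun _ t => t) = 1
  isSimplex : IsSimplex ϖ (wt.support : Set (Vertex F))

/-- `G` acts on the building, by its action on the vertices extended affinely to simplices. -/
instance (ϖ : Fˣ) : MulAction (G F) (Building ϖ) where
  smul g x :=
    { wt := x.wt.mapDomain (fun v => g • v)
      nonneg := fun v => by
        classical
        rw [Finsupp.mapDomain, Finsupp.sum_apply]
        refine Finset.sum_nonneg fun w _ => ?_
        change 0 ≤ (Finsupp.single (g • w) (x.wt w)) v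
        rw [Finsupp.single_apply]
        split_ifs
        · exact x.nonneg w
        · exact le_rfl
      sum_eq_one := by
        rw [Finsupp.sum_mapDomain_index (fun _ => rfl) (fun _ _ _ => rfl)]
        exact x.sum_eq_one
      isSimplex := by
        classical
        rw [Finsupp.mapDomain_support_of_injective (MulAction.injective g), Finset.coe_image]
        obtain ⟨hne, h, hh⟩ := x.isSimplex
        refine ⟨hne.image _, g * h, ?_⟩
        rintro _ ⟨v, hv, rfl⟩
        obtain ⟨w, hw, rfl⟩ := hh hv
        exact ⟨w, hw, mul_smul g h w⟩ }
  one_smul x := by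
    apply Building.ext
    change x.wt.mapDomain (fun v => (1 : G F) • v) = x.wt
    simp only [one_smul]
    exact Finsupp.mapDomain_id
  mul_smul g h x := by
    apply Building.ext
    change x.wt.mapDomain (fun v => (g * h) • v)
      = (x.wt.mapDomain (fun v => h • v)).mapDomain (fun v => g • v)
    rw [← Finsupp.mapDomain_comp]
    congr 1
    funext v
    exact mul_smul g h v

/-- A vertex of the building, as a point. -/
def vertexPt (ϖ : Fˣ) (z : Vertex F) : Building ϖ where
  wt := Finsupp.single z 1
  nonneg v := by
    classical
    rw [Finsupp.single_apply]
    split_ifs <;> norm_num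
  sum_eq_one := by simp
  isSimplex := by
    have hs : ((Finsupp.single z (1 : ℝ)).support : Set (Vertex F)) = {z} := by
      ext v
      simp [eq_comm]
    rw [hs]
    refine ⟨Set.singleton_nonempty z, ?_⟩
    obtain ⟨g, rfl⟩ := QuotientGroup.mk_surjective z
    refine ⟨g * (diagPow ϖ ![0, 0, 0])⁻¹, ?_⟩
    rintro _ rfl
    refine ⟨(diagPow ϖ ![0, 0, 0] : Vertex F), Or.inl rfl, ?_⟩
    change ((g * (diagPow ϖ ![0, 0, 0])⁻¹ * diagPow ϖ ![0, 0, 0] : G F) : Vertex F) = g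
    rw [inv_mul_cancel_right]

/-- The orthogonal projection `ℝ³ → 𝔞 = {x₁ + x₂ + x₃ = 0}`. -/
def projA (x : Fin 3 → ℝ) : EuclideanSpace ℝ (Fin 3) :=
  WithLp.toLp 2 fun i => x i - (∑ j, x j) / 3

/-- `x` lies in the apartment with vertices `g ϖ^l K`, `l ∈ ℤ³`, and `c` assigns to each vertex
of the simplex carrying `x` its coordinates `l` (well defined up to multiples of `(1,1,1)`). -/
def InApartment {ϖ : Fˣ} (g : G F) (c : Vertex F → Fin 3 → ℤ) (x : Building ϖ) : Prop :=
  ∀ v ∈ x.wt.support, v = ((g * diagPow ϖ (c v) : G F) : Vertex F)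

/-- The position in `𝔞` of a point in an apartment with vertex coordinates `c`. -/
def position {ϖ : Fˣ} (c : Vertex F → Fin 3 → ℤ) (x : Building ϖ) : EuclideanSpace ℝ (Fin 3) :=
  x.wt.sum fun v t => t • projA fun i => (c v i : ℝ)

/-- The metric of the building: the Euclidean distance inside an apartment containing both
points, scaled so that adjacent vertices have distance `1`. Two points always lie in a common
apartment and the value does not depend on it, so the infimum is over a nonempty set with only
one element. -/
def bdist {ϖ : Fˣ} (x y : Building ϖ) : ℝ≥0∞ :=
  ⨅ (g : G F) (c : Vertex F → Fin 3 → ℤ) (_ : InApartment g c x ∧ InApartment g c y),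
    ENNReal.ofReal (Real.sqrt (3 / 2) * ‖position c x - position c y‖)

/-- The distance between two vertices. -/
def vdist (ϖ : Fˣ) (z w : Vertex F) : ℝ≥0∞ :=
  bdist (vertexPt ϖ z) (vertexPt ϖ w)

end Building

section Quotient

variable {F : Type*} [Field F] [ValuativeRel F]

/-- `Y = Γ \ G / K`. -/
abbrev Y (Γ : Subgroup (G F)) : Type _ := MulAction.orbitRel.Quotient Γ (Vertex F)

/-- `Ŷ = Γ \ ℬ`. -/
abbrev Yhat (ϖ : Fˣ) (Γ : Subgroup (G F)) : Type _ := MulAction.orbitRel.Quotient Γ (Building ϖ)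

/-- The projection `G / K → Y`. -/
def proj (Γ : Subgroup (G F)) (z : Vertex F) : Y Γ := Quotient.mk'' z

/-- The projection `ℬ → Ŷ`. -/
def projHat (ϖ : Fˣ) (Γ : Subgroup (G F)) (x : Building ϖ) : Yhat ϖ Γ := Quotient.mk'' x

/-- `InjRad_Y(y)`: the supremum of all `r` such that the ball of radius `r` in `ℬ` centered at
a lift of `y` maps injectively to `Ŷ`. -/
def injRadAt (ϖ : Fˣ) (Γ : Subgroup (G F)) (y : Y Γ) : ℝ≥0∞ :=
  ⨆ (r : ℝ≥0) (_ : ∀ z : Vertex F, proj Γ z = y →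
    Set.InjOn (projHat ϖ Γ) {x | bdist (vertexPt ϖ z) x < r}), (r : ℝ≥0∞)

/-- `InjRad(Y)`: the infimum over `y ∈ Y` of `InjRad_Y(y)`. -/
def injRad (ϖ : Fˣ) (Γ : Subgroup (G F)) : ℝ≥0∞ :=
  ⨅ y : Y Γ, injRadAt ϖ Γ y

/-- A fundamental domain for the action of `Γ` on `G / K`: it meets every orbit exactly once. -/
def IsFundDomain (Γ : Subgroup (G F)) (D : Set (Vertex F)) : Prop :=
  ∀ y : Y Γ, ∃! z, z ∈ D ∧ proj Γ z = y

/-- `Kbar` is the kernel on `Y × Y` obtained from the kernel `K` on `G/K × G/K` by summing over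
`Γ`: `Kbar(Γz, Γw) = ∑_γ K(z, γw)`. -/
def IsDescent (Γ : Subgroup (G F)) (K : Vertex F → Vertex F → ℂ) (Kbar : Y Γ → Y Γ → ℂ) : Prop :=
  ∀ z w : Vertex F, HasSum (fun γ : Γ => K z (γ • w)) (Kbar (proj Γ z) (proj Γ w))

/-- `L²(Y)`, for the counting measure on `Y`. -/
abbrev L2 (Γ : Subgroup (G F)) : Type _ := lp (fun _ : Y Γ => ℂ) 2

/-- The operator `T` on `L²(Y)` has kernel function `Kbar`. -/
def HasKernel {Γ : Subgroup (G F)} (T : L2 Γ →L[ℂ] L2 Γ) (Kbar : Y Γ → Y Γ → ℂ) : Prop :=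
  ∀ (f : L2 Γ) (y : Y Γ), HasSum (fun y' => Kbar y y' * f y') (T f y)

end Quotient

/-- The square of the Hilbert–Schmidt norm, computed in the orthonormal basis `e`. -/
def hsNormSq {H : Type*} [NormedAddCommGroup H] [InnerProductSpace ℂ H]
    {ι : Type*} (e : HilbertBasis ι ℂ H) (T : H →L[ℂ] H) : ℝ≥0∞ :=
  ∑' j, ‖T (e j)‖ₑ ^ 2

end Kernel7

end

namespace Kernel7
-- Open compact vertex stabilizers and freeness of the action
section Topology

variable {F : Type*} [Field F] [ValuativeRel F] [TopologicalSpace F] [IsNonarchimedeanLocalField F]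

/-! Vertex stabilizers are open and compact. Compactness makes a discrete torsion-free `Γ` act
freely on vertices; openness then makes `Y` finite, since every orbit contributes the same positive
Haar measure to the finite covolume (`finite_Y`). Every kernel on `Y` is thus a bounded operator,
and by Bessel's inequality its squared Hilbert–Schmidt norm is at most the sum of `|Kbar|²`
(`hsNormSq_le`).

This sum is estimated row by row. If the injectivity radius at `y` exceeds `R`, at most one `γ`
contributes to each entry, and the row is bounded by that of `K` (`tsum_row_le_of_unique`).
Otherwise the row is at most `(∑ |K|)² ≤ N² ‖K‖_∞²`, where `N` bounds the number of vertices at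
distance less than `R`; the factor `1 / InjRad(Y)²` is affordable because `InjRad(Y) ≤ R` as soon as
such a `y` exists, leaving `R² N² ≤ C₁ q^(C₂ R)` (`sq_mul_sq_card_ball_le`).

The bound `N` comes from writing nearby vertices as `z₀ A K` with `A` integral and dividing a power
of the uniformizer, so that finitely many residues determine them (`encard_integralBall_le`). -/

theorem t2Space_localField : T2Space F := by
  let := IsTopologicalAddGroup.rightUniformSpace F
  have := isUniformAddGroup_of_addCommGroup (G := F)
  infer_instance

theorem isTopologicalGroup_G : IsTopologicalGroup (G F) :=
  inferInstanceAs (IsTopologicalGroup (GL (Fin 3) F ⧸ Subgroup.center (GL (Fin 3) F)))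

theorem borelSpace_G {F : Type*} [Field F] [TopologicalSpace F] : BorelSpace (G F) := ⟨rfl⟩

theorem continuous_projGL {F : Type*} [Field F] [TopologicalSpace F] :
    Continuous (Matrix.ProjGenLinGroup.mk : GL (Fin 3) F →* G F) :=
  continuous_coinduced_rng

theorem isOpenMap_projGL :
    IsOpenMap (Matrix.ProjGenLinGroup.mk : GL (Fin 3) F →* G F) :=
  QuotientGroup.isOpenMap_coe (N := Subgroup.center (GL (Fin 3) F))

theorem isOpen_maxCompact : IsOpen (maxCompact F : Set (G F)) := by
  have hO : IsOpenMap (algebraMap 𝒪[F] F) := by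
    have : IsOpen ((𝒪[F] : Set F)) := by
      have := Valuation.isOpen_closedBall (v := ValuativeRel.valuation F) (r := 1) one_ne_zero
      simp only [Valuation.restrict_le_one_iff] at this
      exact this
    exact this.isOpenMap_subtype_val
  have hM : IsOpenMap
      ((algebraMap 𝒪[F] F).mapMatrix : Matrix (Fin 3) (Fin 3) 𝒪[F] →+* Matrix (Fin 3) (Fin 3) F) :=
    IsOpenMap.piMap (f := fun _ => Pi.map fun _ => algebraMap 𝒪[F] F)
      (fun _ => IsOpenMap.piMap (fun _ => hO) (by simp)) (by simp)
  have hG : IsOpenMap (Matrix.GeneralLinearGroup.map (n := Fin 3) (algebraMap 𝒪[F] F)) :=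
    Units.isOpenMap_map (Matrix.map_injective (IsFractionRing.injective _ _)) hM
  have := (isOpenMap_projGL.comp hG).isOpen_range
  rwa [← MonoidHom.coe_comp, ← MonoidHom.coe_range] at this

theorem isCompact_maxCompact : IsCompact (maxCompact F : Set (G F)) := by
  have := t2Space_localField (F := F)
  have hc : CompactSpace (Matrix (Fin 3) (Fin 3) 𝒪[F]) :=
    inferInstanceAs (CompactSpace (Fin 3 → Fin 3 → 𝒪[F]))
  have : CompactSpace (GL (Fin 3) 𝒪[F]) :=
    inferInstanceAs (CompactSpace (Matrix (Fin 3) (Fin 3) 𝒪[F])ˣ)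
  have hcont : Continuous (Matrix.GeneralLinearGroup.map (n := Fin 3) (algebraMap 𝒪[F] F)) := by
    refine Continuous.units_map _ ?_
    exact continuous_id.matrix_map continuous_subtype_val
  have := isCompact_range (continuous_projGL.comp hcont)
  rwa [← MonoidHom.coe_comp, ← MonoidHom.coe_range] at this

/-- A torsion-free discrete subgroup acts freely on the vertices of the building. -/
theorem eq_one_of_smul_eq {Γ : Subgroup (G F)} [DiscreteTopology Γ]
    (hΓ : IsTorsionFreeSubgroup Γ) {γ : Γ} {v : Vertex F} (h : γ • v = v) : γ = 1 := by
  have := isTopologicalGroup_G (F := F)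
  obtain ⟨g, rfl⟩ := QuotientGroup.mk_surjective v
  have hγ : ∀ n : ℕ, g⁻¹ * (γ : G F) ^ n * g ∈ maxCompact F := by
    have h1 : g⁻¹ * (γ : G F) * g ∈ maxCompact F := by
      have : ((γ * g : G F) : Vertex F) = g := h
      rw [mul_assoc]
      exact QuotientGroup.eq.1 this.symm
    intro n
    have : g⁻¹ * (γ : G F) ^ n * g = (g⁻¹ * (γ : G F) * g) ^ n := by
      have := conj_pow (i := n) (a := g⁻¹) (b := (γ : G F))
      rw [inv_inv] at this
      exact this.symm
    rw [this]
    exact pow_mem h1 n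
  by_contra hne
  have hfin : ¬ IsOfFinOrder (γ : G F) := fun hf => hne (Subtype.ext (hΓ _ γ.2 hf))
  -- The conjugated powers of `γ` stay in a compact group, so they cluster. Two of them are then so
  -- close that their quotient, conjugated back, is a power of `γ` in a neighbourhood of `1` meeting
  -- `Γ` only in `1`.
  obtain ⟨x, -, hx⟩ := (isCompact_maxCompact (F := F)).exists_mapClusterPt
    (u := fun n : ℕ => g⁻¹ * (γ : G F) ^ n * g) (f := Filter.atTop)
    (Filter.tendsto_principal.2 (Filter.Eventually.of_forall hγ))
  obtain ⟨U, hU, hU1⟩ := (discreteTopology_subtype_iff' (Y := G F) (S := (Γ : Set (G F)))).1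
    inferInstance 1 Γ.one_mem
  have hcont : Continuous fun q : G F × G F => g * (q.1⁻¹ * q.2) * g⁻¹ := by fun_prop
  have hmem : (fun q : G F × G F => g * (q.1⁻¹ * q.2) * g⁻¹) ⁻¹' U ∈ nhds (x, x) := by
    refine (hU.preimage hcont).mem_nhds ?_
    have : (1 : G F) ∈ U := (hU1.symm ▸ Set.mem_singleton _ : (1 : G F) ∈ U ∩ Γ).1
    simpa using this
  obtain ⟨V, W, hV, hx', hW, hx'', hVW⟩ := mem_nhds_prod_iff'.1 hmem
  have hfr := Filter.frequently_atTop'.1 (hx.frequently ((hV.inter hW).mem_nhds ⟨hx', hx''⟩))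
  obtain ⟨n, -, hn⟩ := hfr 0
  obtain ⟨m, hnm, hm⟩ := hfr n
  have h1 : g * ((g⁻¹ * (γ : G F) ^ n * g)⁻¹ * (g⁻¹ * (γ : G F) ^ m * g)) * g⁻¹ ∈ U :=
    hVW (Set.mk_mem_prod hn.1 hm.2)
  have h2 : g * ((g⁻¹ * (γ : G F) ^ n * g)⁻¹ * (g⁻¹ * (γ : G F) ^ m * g)) * g⁻¹
      = (γ : G F) ^ (m - n) := by
    rw [pow_sub _ hnm.le, ((Commute.refl (γ : G F)).pow_pow m n).inv_right.eq]
    group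
  rw [h2] at h1
  have h3 : (γ : G F) ^ (m - n) ∈ U ∩ (Γ : Set (G F)) := ⟨h1, Γ.pow_mem γ.2 _⟩
  rw [hU1] at h3
  exact hfin (isOfFinOrder_iff_pow_eq_one.2 ⟨m - n, Nat.sub_pos_of_lt hnm, h3⟩)

end Topology

/-! ### Counting lattices of bounded elementary divisors -/

section Counting

variable {F : Type*} [Field F] [ValuativeRel F]

/-- The vertices `z₀ A K` for integral matrices `A` dividing `p ^ M`. -/
def integralBall (p : 𝒪[F]) (z₀ : G F) (M : ℕ) : Set (Vertex F) :=
  {v | ∃ (A B : Matrix (Fin 3) (Fin 3) 𝒪[F]) (a : GL (Fin 3) F),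
    (a : Matrix (Fin 3) (Fin 3) F) = A.map (algebraMap 𝒪[F] F) ∧ A * B = p ^ M • 1 ∧
      v = ((z₀ * Matrix.ProjGenLinGroup.mk a : G F) : Vertex F)}

theorem mk_eq_of_integral_mul {z₀ : G F} {a a' : GL (Fin 3) F} (U : GL (Fin 3) 𝒪[F])
    (h : a' = a * Matrix.GeneralLinearGroup.map (algebraMap 𝒪[F] F) U) :
    ((z₀ * Matrix.ProjGenLinGroup.mk a' : G F) : Vertex F)
      = ((z₀ * Matrix.ProjGenLinGroup.mk a : G F) : Vertex F) := by
  refine (QuotientGroup.eq.2 ?_).symm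
  refine ⟨U, ?_⟩
  subst h
  simp only [map_mul, MonoidHom.coe_comp, Function.comp_apply]
  group

theorem isUnit_one_add_smul {R : Type*} [CommRing R] [IsLocalRing R] {p : R}
    (hp : p ∈ IsLocalRing.maximalIdeal R) {n : Type*} [Fintype n] [DecidableEq n]
    (X : Matrix n n R) : IsUnit (1 + p • X) := by
  rw [Matrix.isUnit_iff_isUnit_det]
  by_contra h
  have h1 := (IsLocalRing.residue_eq_zero_iff _).2 ((IsLocalRing.mem_maximalIdeal _).2 h)
  rw [RingHom.map_det] at h1
  have h2 : (IsLocalRing.residue R).mapMatrix (1 + p • X) = 1 := by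
    ext i j
    have hp' := (IsLocalRing.residue_eq_zero_iff _).2 hp
    by_cases hij : i = j <;> simp [hp', Matrix.one_apply, hij]
  rw [h2, Matrix.det_one] at h1
  exact one_ne_zero h1

/-- The residue of `A` modulo `p ^ (M + 1)` determines the vertex: if `A' = A + p ^ (M + 1) X` and
`A B = p ^ M`, then `A' = A (1 + p B X)`. The extra power of `p` makes the last factor invertible
over `𝒪`. Nine entries give the exponent. -/
theorem encard_integralBall_le [IsDiscreteValuationRing 𝒪[F]] [Finite 𝓀[F]] {p : 𝒪[F]}
    (hp : Irreducible p) (z₀ : G F) (M : ℕ) :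
    (integralBall p z₀ M).encard ≤ ((Nat.card 𝓀[F] ^ (9 * (M + 1)) : ℕ) : ℕ∞) := by
  have hmax := hp.maximalIdeal_eq
  set I : Ideal 𝒪[F] := IsLocalRing.maximalIdeal 𝒪[F] ^ (M + 1) with hI
  have hcard : Nat.card (𝒪[F] ⧸ I) = Nat.card 𝓀[F] ^ (M + 1) := by
    have := cardQuot_pow_of_prime (P := IsLocalRing.maximalIdeal 𝒪[F])
      (IsDiscreteValuationRing.not_a_field _) (i := M + 1)
    rw [Submodule.cardQuot_apply, Submodule.cardQuot_apply] at this
    exact this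
  have : Finite (𝒪[F] ⧸ I) := Nat.finite_of_card_ne_zero <| by
    rw [hcard]; exact pow_ne_zero _ Nat.card_pos.ne'
  let f : integralBall p z₀ M → (Fin 3 → Fin 3 → 𝒪[F] ⧸ I) :=
    fun v i j => Ideal.Quotient.mk I (v.2.choose i j)
  have hf : Function.Injective f := by
    rintro v v' h
    obtain ⟨B, a, ha, hAB, hv⟩ := v.2.choose_spec
    obtain ⟨B', a', ha', hAB', hv'⟩ := v'.2.choose_spec
    have hX : ∀ i j, ∃ x, v'.2.choose i j = v.2.choose i j + p ^ (M + 1) * x := by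
      intro i j
      have h1 : v'.2.choose i j - v.2.choose i j ∈ I :=
        Ideal.Quotient.eq.1 (congrFun (congrFun h i) j).symm
      rw [hI, hmax, Ideal.span_singleton_pow, Ideal.mem_span_singleton] at h1
      obtain ⟨x, hx⟩ := h1
      exact ⟨x, by rw [← hx]; ring⟩
    choose X hX using hX
    have hA' : v'.2.choose = v.2.choose + p ^ (M + 1) • Matrix.of X := by
      ext i j; simp [hX]
    have hpm : p ∈ IsLocalRing.maximalIdeal 𝒪[F] := by
      rw [hmax]; exact Ideal.mem_span_singleton_self p
    obtain ⟨U, hU⟩ := isUnit_one_add_smul hpm (B * Matrix.of X)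
    have hAU : v'.2.choose = v.2.choose * U := by
      rw [hU, mul_add, mul_one, Matrix.mul_smul, ← mul_assoc, hAB, hA', smul_mul_assoc, one_mul,
        smul_smul, pow_succ']
    refine Subtype.ext (hv.trans ((mk_eq_of_integral_mul U ?_).symm.trans hv'.symm))
    apply Units.ext
    rw [ha', hAU, Matrix.map_mul, Units.val_mul, ha]
    rfl
  refine (ENat.card_le_card_of_injective hf).trans ?_
  rw [ENat.card_eq_coe_natCard]
  simp only [Nat.card_pi, hcard, Finset.prod_const, Finset.card_univ, Fintype.card_fin]
  rw [← pow_mul, ← pow_mul]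
  exact_mod_cast le_of_eq (by ring)

theorem exists_mul_pow_integral [IsDiscreteValuationRing 𝒪[F]] {p : 𝒪[F]} (hp : Irreducible p)
    (A : Matrix (Fin 3) (Fin 3) F) : ∃ (n : ℕ) (B : Matrix (Fin 3) (Fin 3) 𝒪[F]),
      B.map (algebraMap 𝒪[F] F) = (p : F) ^ n • A := by
  have h1 : ∀ x : F, ∃ n : ℕ, ∀ m ≥ n, ∃ b : 𝒪[F], (b : F) = (p : F) ^ m * x := by
    intro x
    obtain ⟨a, b, hb, rfl⟩ := IsFractionRing.div_surjective (A := 𝒪[F]) x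
    obtain ⟨n, u, hu⟩ := IsDiscreteValuationRing.eq_unit_mul_pow_irreducible
      (nonZeroDivisors.ne_zero hb) hp
    refine ⟨n, fun m hm => ⟨p ^ (m - n) * a * (u⁻¹ : 𝒪[F]ˣ), ?_⟩⟩
    have hp0 : (p : F) ≠ 0 := by simpa using hp.ne_zero
    have hb0 : (algebraMap 𝒪[F] F) b ≠ 0 := by simpa using nonZeroDivisors.ne_zero hb
    rw [mul_div_assoc', eq_div_iff hb0, hu]
    have : (((u⁻¹ : 𝒪[F]ˣ) : 𝒪[F]) : F) * ((u : 𝒪[F]) : F) = 1 := by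
      rw [← Subring.coe_mul]; simp
    change ((p : F) ^ (m - n) * (a : F) * (((u⁻¹ : 𝒪[F]ˣ) : 𝒪[F]) : F)) *
      (((u : 𝒪[F]) : F) * (p : F) ^ n) = (p : F) ^ m * (a : F)
    calc _ = ((((u⁻¹ : 𝒪[F]ˣ) : 𝒪[F]) : F) * ((u : 𝒪[F]) : F)) *
          ((p : F) ^ (m - n) * (p : F) ^ n) * (a : F) := by ring
      _ = _ := by rw [this, ← pow_add, Nat.sub_add_cancel hm, one_mul]
  choose n hn using fun i j => h1 (A i j)
  have hle : ∀ i j, n i j ≤ ∑ i, ∑ j, n i j := fun i j =>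
    (Finset.single_le_sum (f := fun j => n i j) (fun _ _ => Nat.zero_le _) (Finset.mem_univ j)).trans
    (Finset.single_le_sum (f := fun i => ∑ j, n i j) (fun _ _ => Nat.zero_le _) (Finset.mem_univ i))
  choose B hB using fun i j => hn i j _ (hle i j)
  exact ⟨_, Matrix.of B, by ext i j; exact hB i j⟩

theorem countable_vertex [IsDiscreteValuationRing 𝒪[F]] [Finite 𝓀[F]] : Countable (Vertex F) := by
  obtain ⟨p, hp⟩ := IsDiscreteValuationRing.exists_irreducible 𝒪[F]
  have hp0 : (p : F) ≠ 0 := by simpa using hp.ne_zero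
  -- Clearing denominators of `a` and `a⁻¹` exhibits the vertex in some ball; the scalar used is
  -- trivial in `PGL`.
  have hcov : (Set.univ : Set (Vertex F)) ⊆ ⋃ M, integralBall p 1 M := by
    rintro v -
    obtain ⟨g, rfl⟩ := QuotientGroup.mk_surjective v
    induction g using Matrix.ProjGenLinGroup.induction_on with | mk a => ?_
    obtain ⟨n, A, hA⟩ := exists_mul_pow_integral hp (a : Matrix (Fin 3) (Fin 3) F)
    obtain ⟨m, B, hB⟩ := exists_mul_pow_integral hp ((a⁻¹ : GL (Fin 3) F) : Matrix (Fin 3) (Fin 3) F)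
    refine Set.mem_iUnion.2 ⟨n + m, A, B,
      a * Matrix.GeneralLinearGroup.scalar (Fin 3) (Units.mk0 (p : F) hp0 ^ n), ?_, ?_, ?_⟩
    · rw [hA]
      ext i j
      simp [Matrix.diagonal_pow, mul_comm]
    · apply Matrix.map_injective (f := algebraMap 𝒪[F] F) (IsFractionRing.injective _ _)
      beta_reduce
      rw [Matrix.map_mul, hA, hB, smul_mul_assoc, Matrix.mul_smul, smul_smul, ← Units.val_mul,
        mul_inv_cancel, ← pow_add]
      ext i j
      by_cases hij : i = j
      · simp [hij]; rfl
      · simp [hij]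
    · rw [map_mul, Matrix.ProjGenLinGroup.mk_scalar, one_mul, mul_one]
  refine Set.countable_univ_iff.1 ((Set.countable_iUnion fun M => ?_).mono hcov)
  exact (Set.finite_of_encard_le_coe (encard_integralBall_le hp 1 M)).countable

end Counting
-- From building distance to integral matrices; injectivity radius
section Distance

variable {F : Type*} [Field F]

theorem diagPow_add (ϖ : Fˣ) (l m : Fin 3 → ℤ) :
    (diagPow ϖ (l + m) : G F) = diagPow ϖ l * diagPow ϖ m := by
  unfold diagPow
  rw [← map_mul]
  congr 1
  apply Units.ext
  ext i j
  by_cases hij : i = j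
  · subst hij; simp [zpow_add]
  · simp [hij]

theorem diagPow_const (ϖ : Fˣ) (n : ℤ) : (diagPow ϖ (fun _ => n) : G F) = 1 := by
  rw [← Matrix.ProjGenLinGroup.mk_scalar (ϖ ^ n)]
  unfold diagPow
  congr 1

variable [ValuativeRel F]

theorem inApartment_vertexPt {ϖ : Fˣ} {g : G F} {c : Vertex F → Fin 3 → ℤ} {z : Vertex F} :
    InApartment g c (vertexPt ϖ z) ↔ z = ((g * diagPow ϖ (c z) : G F) : Vertex F) := by
  unfold InApartment vertexPt
  simp

theorem position_vertexPt {ϖ : Fˣ} (c : Vertex F → Fin 3 → ℤ) (z : Vertex F) :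
    position c (vertexPt ϖ z) = projA fun i => (c z i : ℝ) := by
  simp [position, vertexPt]

/-- Taking the difference of two coordinates cancels the mean removed by `projA`; each coordinate is
at most the norm, hence the factor `2`. -/
theorem sub_le_of_norm_projA_sub_lt {a b : Fin 3 → ℤ} {R : ℝ}
    (h : Real.sqrt (3 / 2) * ‖projA (fun i => (a i : ℝ)) - projA (fun i => (b i : ℝ))‖ < R)
    (i j : Fin 3) : ((b i - a i - (b j - a j) : ℤ) : ℝ) < 2 * R := by
  set x := projA (fun i => (a i : ℝ)) - projA (fun i => (b i : ℝ)) with hx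
  have h1 : ‖x‖ ≤ Real.sqrt (3 / 2) * ‖x‖ :=
    le_mul_of_one_le_left (norm_nonneg _) (Real.one_le_sqrt.2 (by norm_num))
  have hi := (abs_le.1 (PiLp.norm_apply_le x i)).1
  have hj := (abs_le.1 (PiLp.norm_apply_le x j)).2
  have hxi : ∀ i, x i = (a i - (∑ k, (a k : ℝ)) / 3) - (b i - (∑ k, (b k : ℝ)) / 3) :=
    fun i => rfl
  rw [hxi] at hi hj
  push_cast
  linarith

theorem mul_diagPow_mem_integralBall {ϖ : Fˣ} {p : 𝒪[F]} (hp : (p : F) = ϖ) {h z₀ : G F}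
    (hz : (h : Vertex F) = (z₀ : Vertex F)) {M : ℕ} {l : Fin 3 → ℕ} (hl : ∀ i, l i ≤ M) :
    ((h * diagPow ϖ (fun i => (l i : ℤ)) : G F) : Vertex F) ∈ integralBall p z₀ M := by
  obtain ⟨k, hk⟩ := QuotientGroup.eq.1 hz.symm
  have hh : h = z₀ * Matrix.ProjGenLinGroup.mk
      (Matrix.GeneralLinearGroup.map (algebraMap 𝒪[F] F) k) := by
    rw [show Matrix.ProjGenLinGroup.mk (Matrix.GeneralLinearGroup.map (algebraMap 𝒪[F] F) k)
      = z₀⁻¹ * h from hk, mul_inv_cancel_left]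
  refine ⟨(k : Matrix (Fin 3) (Fin 3) 𝒪[F]) * Matrix.diagonal fun i => p ^ l i,
    (Matrix.diagonal fun i => p ^ (M - l i)) *
      ((k⁻¹ : GL (Fin 3) 𝒪[F]) : Matrix (Fin 3) (Fin 3) 𝒪[F]),
    Matrix.GeneralLinearGroup.map (algebraMap 𝒪[F] F) k *
      Units.map (Matrix.diagonalRingHom (Fin 3) F).toMonoidHom
        (MulEquiv.piUnits.symm fun i => ϖ ^ (l i : ℤ)), ?_, ?_, ?_⟩
  · rw [Matrix.map_mul, Units.val_mul, Matrix.diagonal_map (map_zero _)]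
    congr 1
    simp only [zpow_natCast]
    change Matrix.diagonal (fun i => ((ϖ ^ l i : Fˣ) : F)) = _
    congr 1
    funext i
    rw [Units.val_pow_eq_pow_val, ← hp, map_pow]
    rfl
  · rw [mul_assoc, ← mul_assoc (Matrix.diagonal _) (Matrix.diagonal _), Matrix.diagonal_mul_diagonal]
    have : (Matrix.diagonal fun i => p ^ l i * p ^ (M - l i) : Matrix (Fin 3) (Fin 3) 𝒪[F])
        = p ^ M • 1 := by
      rw [← Matrix.diagonal_one, ← Matrix.diagonal_smul]
      congr 1
      funext i
      simp [← pow_add, Nat.add_sub_cancel' (hl i)]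
    rw [this, smul_mul_assoc, one_mul, Matrix.mul_smul, ← Units.val_mul, mul_inv_cancel,
      Units.val_one]
  · rw [map_mul, ← mul_assoc, ← hh]
    rfl

/-- A single apartment witnessing the strict inequality suffices, so neither existence of common
apartments nor independence of the choice is needed. -/
theorem mem_integralBall_of_vdist_lt {ϖ : Fˣ} {p : 𝒪[F]} (hp : (p : F) = ϖ) {z₀ : G F}
    {w : Vertex F} {R : ℝ} (h : vdist ϖ (z₀ : Vertex F) w < ENNReal.ofReal R) :
    w ∈ integralBall p z₀ ⌊2 * R⌋₊ := by
  unfold vdist bdist at h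
  simp only [iInf_lt_iff] at h
  obtain ⟨g, c, ⟨hz, hw⟩, h⟩ := h
  rw [position_vertexPt, position_vertexPt] at h
  replace h := ENNReal.ofReal_lt_ofReal_iff'.1 h |>.1
  rw [inApartment_vertexPt] at hz hw
  have hb := sub_le_of_norm_projA_sub_lt h
  set a := c (z₀ : Vertex F)
  -- Subtracting the least coordinate is a shift by a multiple of `(1,1,1)`, trivial in `PGL`; it
  -- makes all exponents lie between `0` and `2R`.
  obtain ⟨j, hj⟩ := Finite.exists_min fun i => c w i - a i
  have key := mul_diagPow_mem_integralBall (ϖ := ϖ) (M := ⌊2 * R⌋₊) hp hz.symm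
    (l := fun i => (c w i - a i - (c w j - a j)).toNat) (fun i => by
      have hnn : 0 ≤ c w i - a i - (c w j - a j) := sub_nonneg.2 (hj i)
      refine Nat.le_floor ?_
      have : (((c w i - a i - (c w j - a j)).toNat : ℤ) : ℝ)
        = ((c w i - a i - (c w j - a j) : ℤ) : ℝ) := by rw [Int.toNat_of_nonneg hnn]
      rw [Int.cast_natCast] at this
      rw [this]
      exact (hb i j).le)
  convert key using 1
  refine hw.trans ?_
  have hsum : (a + fun i => (((c w i - a i - (c w j - a j)).toNat : ℕ) : ℤ))
      + (fun _ => c w j - a j) = c w := by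
    funext i
    simp only [Pi.add_apply]
    rw [Int.toNat_of_nonneg (sub_nonneg.2 (hj i))]
    ring
  have h2 : diagPow ϖ (c w) = diagPow ϖ a *
      diagPow ϖ fun i => (((c w i - a i - (c w j - a j)).toNat : ℕ) : ℤ) := by
    rw [← diagPow_add, ← mul_one (diagPow ϖ (a + _)), ← diagPow_const ϖ (c w j - a j),
      ← diagPow_add, hsum]
  rw [h2, mul_assoc]

theorem encard_vdist_lt_le [IsDiscreteValuationRing 𝒪[F]] [Finite 𝓀[F]] {ϖ : Fˣ}
    (hϖ : IsUniformizer ϖ) (z : Vertex F) (R : ℝ) :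
    {w | vdist ϖ z w < ENNReal.ofReal R}.encard
      ≤ ((Nat.card 𝓀[F] ^ (9 * (⌊2 * R⌋₊ + 1)) : ℕ) : ℕ∞) := by
  obtain ⟨p, hp, hpϖ⟩ := hϖ
  obtain ⟨z₀, rfl⟩ := QuotientGroup.mk_surjective z
  exact (Set.encard_le_encard fun w hw => mem_integralBall_of_vdist_lt hpϖ hw).trans
    (encard_integralBall_le hp z₀ _)

theorem two_le_card_residueField [Finite 𝓀[F]] : 2 ≤ Nat.card 𝓀[F] :=
  Finite.one_lt_card

/-- `R ≤ e^R ≤ 4^R ≤ q^(2R)` costs `q^(4R)`, and the squared count costs `q^(36R + 18)`. -/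
theorem sq_mul_sq_card_ball_le {q : ℕ} (hq : 2 ≤ q) {R : ℝ} (hR : 0 ≤ R) :
    R ^ 2 * (((q ^ (9 * (⌊2 * R⌋₊ + 1)) : ℕ) : ℝ)) ^ 2 ≤ (q : ℝ) ^ 18 * (q : ℝ) ^ (40 * R) := by
  have hq' : (2 : ℝ) ≤ q := by exact_mod_cast hq
  have hq0 : (0 : ℝ) < q := by linarith
  have h1 : R ≤ (q : ℝ) ^ (2 * R) := by
    have h4 : (4 : ℝ) ≤ (q : ℝ) ^ (2 : ℝ) := by
      rw [Real.rpow_two]; nlinarith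
    calc R ≤ Real.exp R := by linarith [Real.add_one_le_exp R]
      _ = (Real.exp 1) ^ R := by rw [← Real.exp_mul, one_mul]
      _ ≤ 4 ^ R := Real.rpow_le_rpow (Real.exp_pos _).le (by linarith [Real.exp_one_lt_d9]) hR
      _ ≤ ((q : ℝ) ^ (2 : ℝ)) ^ R := Real.rpow_le_rpow (by norm_num) h4 hR
      _ = _ := by rw [← Real.rpow_mul hq0.le]
  have h2 : (((q ^ (9 * (⌊2 * R⌋₊ + 1)) : ℕ) : ℝ)) ≤ (q : ℝ) ^ (9 * (2 * R + 1)) := by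
    rw [Nat.cast_pow, ← Real.rpow_natCast]
    refine Real.rpow_le_rpow_of_exponent_le (by linarith) ?_
    push_cast
    have := Nat.floor_le (show 0 ≤ 2 * R by linarith)
    linarith
  calc _ ≤ ((q : ℝ) ^ (2 * R)) ^ 2 * ((q : ℝ) ^ (9 * (2 * R + 1))) ^ 2 := by gcongr
    _ = _ := by
      rw [← Real.rpow_natCast _ 2, ← Real.rpow_natCast _ 2, ← Real.rpow_natCast _ 18,
        ← Real.rpow_mul hq0.le, ← Real.rpow_mul hq0.le, ← Real.rpow_add hq0, ← Real.rpow_add hq0]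
      congr 1
      push_cast
      ring

theorem smul_vertexPt (ϖ : Fˣ) (g : G F) (z : Vertex F) :
    g • vertexPt ϖ z = vertexPt ϖ (g • z) := by
  apply Building.ext
  exact Finsupp.mapDomain_single

theorem projHat_smul_vertexPt (ϖ : Fˣ) (Γ : Subgroup (G F)) (γ : Γ) (z : Vertex F) :
    projHat ϖ Γ (vertexPt ϖ (γ • z)) = projHat ϖ Γ (vertexPt ϖ z) :=
  MulAction.orbitRel.Quotient.mem_orbit.1 ⟨γ, smul_vertexPt ϖ (γ : G F) z⟩

theorem vertexPt_injective (ϖ : Fˣ) : Function.Injective (vertexPt ϖ : Vertex F → Building ϖ) :=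
  fun _ _ h => Finsupp.single_left_injective one_ne_zero (congrArg Building.wt h)

theorem eq_of_lt_injRadAt {ϖ : Fˣ} {Γ : Subgroup (G F)} {z w : Vertex F} {R : ℝ}
    (hR : ENNReal.ofReal R < injRadAt ϖ Γ (proj Γ z)) {γ γ' : Γ}
    (h : vdist ϖ z (γ • w) < ENNReal.ofReal R) (h' : vdist ϖ z (γ' • w) < ENNReal.ofReal R) :
    γ • w = γ' • w := by
  unfold injRadAt at hR
  simp only [lt_iSup_iff] at hR
  obtain ⟨r, hr, hRr⟩ := hR
  refine vertexPt_injective ϖ (hr z rfl (h.trans hRr) (h'.trans hRr) ?_)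
  rw [projHat_smul_vertexPt, projHat_smul_vertexPt]

end Distance

/-! ### Finiteness of `Y` from finite covolume -/

section FiniteQuotient

open MeasureTheory
open scoped Pointwise

variable {F : Type*} [Field F] [ValuativeRel F]

/-- If `Γ` acts freely, the translates of representatives of the orbits are all distinct. -/
theorem injective_smul_rep {Γ : Subgroup (G F)} (hfree : ∀ (γ : Γ) (v : Vertex F), γ • v = v → γ = 1)
    {r : Y Γ → Vertex F} (hr : ∀ y, proj Γ (r y) = y) :
    Function.Injective fun q : (_ : Y Γ) × Γ => q.2 • r q.1 := by
  have hproj : ∀ (γ : Γ) v, proj Γ (γ • v) = proj Γ v := fun γ v =>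
    Quotient.sound' ⟨γ, rfl⟩
  rintro ⟨y, γ⟩ ⟨y', γ'⟩ h
  dsimp only at h
  have hy : y = y' := by rw [← hr y, ← hr y', ← hproj γ, h, hproj]
  subst hy
  have := hfree (γ'⁻¹ * γ) (r y) (by rw [mul_smul, h, inv_smul_smul])
  rw [inv_mul_eq_one.1 this]

theorem tsum_tsum_smul_rep_le {Γ : Subgroup (G F)}
    (hfree : ∀ (γ : Γ) (v : Vertex F), γ • v = v → γ = 1)
    {r : Y Γ → Vertex F} (hr : ∀ y, proj Γ (r y) = y) (f : Vertex F → ℝ≥0∞) :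
    ∑' (y : Y Γ) (γ : Γ), f (γ • r y) ≤ ∑' v, f v := by
  rw [← ENNReal.tsum_sigma' (f := fun q : (_ : Y Γ) × Γ => f (q.2 • r q.1))]
  exact ENNReal.tsum_comp_le_tsum_of_injective (injective_smul_rep hfree hr) f

variable [TopologicalSpace F] [IsNonarchimedeanLocalField F]

theorem finite_Y {Γ : Subgroup (G F)} (hΓ : IsLatticeIn Γ) (hT : IsTorsionFreeSubgroup Γ) :
    Finite (Y Γ) := by
  have := isTopologicalGroup_G (F := F)
  have : BorelSpace (G F) := borelSpace_G
  have := countable_vertex (F := F)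
  obtain ⟨_, μ, hμ, s, hs, hfin⟩ := hΓ
  have hfree : ∀ (γ : Γ) (v : Vertex F), γ • v = v → γ = 1 := fun γ v h => eq_one_of_smul_eq hT h
  have hr : ∀ y : Y Γ, proj Γ y.out = y := fun y => Quotient.out_eq' y
  -- A free orbit embeds `Γ` in the countable vertex set; countability is needed to sum measures
  -- over `Γ`.
  have : Countable Γ := Function.Injective.countable 
      (f := fun γ : Γ => γ • (((1 : G F)) : Vertex F)) <| by
    intro γ γ' h
    dsimp only at h
    have := hfree (γ'⁻¹ * γ) _ (by rw [mul_smul, h, inv_smul_smul])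
    rw [inv_mul_eq_one.1 this]
  let P : Vertex F → Set (G F) := fun v => {g | (g : Vertex F) = v}
  have hPg : ∀ g : G F, P (g : Vertex F) = g • (maxCompact F : Set (G F)) := by
    intro g
    ext h
    rw [Set.mem_smul_set_iff_inv_smul_mem]
    exact eq_comm.trans QuotientGroup.eq
  have hPopen : ∀ v, IsOpen (P v) := by
    intro v
    obtain ⟨g, rfl⟩ := QuotientGroup.mk_surjective v
    rw [hPg]
    exact isOpen_maxCompact.smul g
  have hPμ : ∀ v, μ (P v) = μ (maxCompact F : Set (G F)) := by
    intro v
    obtain ⟨g, rfl⟩ := QuotientGroup.mk_surjective v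
    rw [hPg, measure_smul]
  have hPsmul : ∀ (γ : Γ) v, γ • P v = P (γ • v) := by
    intro γ v
    ext h
    rw [Set.mem_smul_set_iff_inv_smul_mem]
    change γ⁻¹ • (h : Vertex F) = v ↔ (h : Vertex F) = γ • v
    rw [inv_smul_eq_iff]
  have h1 : ∑' v, μ (P v ∩ s) ≤ μ s := by
    refine (tsum_meas_le_meas_iUnion_of_disjoint₀ μ
      (fun v => (hPopen v).measurableSet.nullMeasurableSet.inter hs.nullMeasurableSet) ?_).trans
      (measure_mono (Set.iUnion_subset fun v => Set.inter_subset_right))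
    intro v w hvw
    refine Disjoint.aedisjoint (Set.disjoint_left.2 fun g hg hg' => hvw ?_)
    exact hg.1.symm.trans hg'.1
  -- The measure of one coset of the stabilizer is spread over its `Γ`-translates inside `s`, and
  -- translates for different orbits or different `γ` are disjoint. So `s` has room for only
  -- finitely many orbits.
  have h2 : ∑' _ : Y Γ, μ (maxCompact F : Set (G F)) ≤ μ s := by
    refine le_trans (le_of_eq (tsum_congr fun y => ?_))
      ((tsum_tsum_smul_rep_le hfree hr fun v => μ (P v ∩ s)).trans h1)
    rw [← hPμ y.out, hs.measure_eq_tsum]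
    simp_rw [hPsmul]
  by_contra hinf
  rw [not_finite_iff_infinite] at hinf
  rw [ENNReal.tsum_const_eq_top_of_ne_zero] at h2
  · exact absurd hfin (not_lt.2 h2)
  · exact (isOpen_maxCompact.measure_pos μ ⟨1, one_mem _⟩).ne'

end FiniteQuotient
-- Operators with a kernel on a finite quotient
section Operator

variable {F : Type*} [Field F] [ValuativeRel F] {Γ : Subgroup (G F)}

theorem enorm_sq_eq_ofReal {E : Type*} [SeminormedAddCommGroup E] (x : E) :
    ‖x‖ₑ ^ 2 = ENNReal.ofReal (‖x‖ ^ 2) := by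
  rw [ENNReal.ofReal_pow (norm_nonneg _), ofReal_norm]

theorem L2.enorm_sq (f : L2 Γ) : ‖f‖ₑ ^ 2 = ∑' y, ‖f y‖ₑ ^ 2 := by
  have h := lp.hasSum_norm (p := 2) (by norm_num) f
  simp only [ENNReal.toReal_ofNat, Real.rpow_two] at h
  simp_rw [enorm_sq_eq_ofReal]
  rw [← h.tsum_eq, ENNReal.ofReal_tsum_of_nonneg (fun _ => sq_nonneg _) h.summable]

/-- Bessel's inequality. -/
theorem tsum_enorm_inner_sq_le {H : Type*} [NormedAddCommGroup H] [InnerProductSpace ℂ H]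
    {ι : Type*} {e : ι → H} (he : Orthonormal ℂ e) (x : H) :
    ∑' j, ‖inner ℂ (e j) x‖ₑ ^ 2 ≤ ‖x‖ₑ ^ 2 := by
  rw [ENNReal.tsum_eq_iSup_sum]
  refine iSup_le fun s => ?_
  simp_rw [enorm_sq_eq_ofReal]
  rw [← ENNReal.ofReal_sum_of_nonneg fun _ _ => sq_nonneg _]
  exact ENNReal.ofReal_le_ofReal (he.sum_inner_products_le x)

theorem exists_hasKernel [Finite (Y Γ)] (Kbar : Y Γ → Y Γ → ℂ) :
    ∃ T : L2 Γ →L[ℂ] L2 Γ, HasKernel T Kbar := by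
  have := Fintype.ofFinite (Y Γ)
  have : FiniteDimensional ℂ (L2 Γ) :=
    (lpPiLpₗᵢ (p := 2) (fun _ : Y Γ => ℂ) ℂ).symm.toLinearEquiv.finiteDimensional
  let T : L2 Γ →ₗ[ℂ] L2 Γ :=
    { toFun := fun f => ⟨fun y => ∑ y', Kbar y y' * f y', Memℓp.all _⟩
      map_add' := fun f g => by
        ext y
        change ∑ y', Kbar y y' * (f y' + g y') = _
        simp_rw [mul_add, Finset.sum_add_distrib]
        rfl
      map_smul' := fun c f => by
        ext y
        change ∑ y', Kbar y y' * (c * f y') = c * ∑ y', Kbar y y' * f y'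
        simp_rw [Finset.mul_sum, mul_left_comm] }
  exact ⟨LinearMap.toContinuousLinearMap T, fun f y => hasSum_fintype _⟩

/-- The value of `T (e j)` at `y` is the inner product of `e j` with the conjugated row of `Kbar` at
`y`; Bessel's inequality is applied to each row after exchanging the sums. -/
theorem hsNormSq_le [Finite (Y Γ)] {Kbar : Y Γ → Y Γ → ℂ} {T : L2 Γ →L[ℂ] L2 Γ}
    (hT : HasKernel T Kbar) {ι : Type*} (e : HilbertBasis ι ℂ (L2 Γ)) :
    hsNormSq e T ≤ ∑' (y : Y Γ) (y' : Y Γ), ‖Kbar y y'‖ₑ ^ 2 := by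
  unfold hsNormSq
  simp_rw [L2.enorm_sq]
  rw [ENNReal.tsum_comm]
  refine ENNReal.tsum_le_tsum fun y => ?_
  let k : L2 Γ := ⟨fun y' => star (Kbar y y'), Memℓp.all _⟩
  have hk : ∀ f : L2 Γ, T f y = inner ℂ k f := fun f => by
    refine (hT f y).unique ?_
    have : (fun y' => Kbar y y' * f y') = fun y' => inner ℂ (k y') (f y') := by
      funext y'
      change _ = f y' * star (star (Kbar y y'))
      rw [star_star, mul_comm]
    rw [this]
    exact lp.hasSum_inner k f
  have hk' : ∀ j, ‖T (e j) y‖ₑ = ‖inner ℂ (e j) k‖ₑ := fun j => by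
    rw [hk, ← ofReal_norm, ← ofReal_norm, norm_inner_symm]
  simp_rw [hk']
  refine (tsum_enorm_inner_sq_le e.orthonormal k).trans (le_of_eq ?_)
  rw [L2.enorm_sq]
  refine tsum_congr fun y' => ?_
  change ‖star (Kbar y y')‖ₑ ^ 2 = _
  rw [← ofReal_norm, ← ofReal_norm, norm_star]

end Operator

/-! ### Descending the kernel and bounding its rows -/

section Descent

variable {F : Type*} [Field F] [ValuativeRel F] {Γ : Subgroup (G F)}

theorem proj_eq_iff {z w : Vertex F} : proj Γ z = proj Γ w ↔ ∃ γ : Γ, γ • w = z :=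
  Quotient.eq''

theorem exists_isDescent {K : Vertex F → Vertex F → ℂ}
    (hK : ∀ (γ : Γ) (z w : Vertex F), K (γ • z) (γ • w) = K z w)
    (hfree : ∀ (γ : Γ) (v : Vertex F), γ • v = v → γ = 1)
    (hfin : ∀ z, {w | K z w ≠ 0}.Finite) : ∃ Kbar : Y Γ → Y Γ → ℂ, IsDescent Γ K Kbar := by
  refine ⟨fun y y' => ∑' γ : Γ, K y.out (γ • y'.out), fun z w => ?_⟩
  obtain ⟨α, hα⟩ := proj_eq_iff.1 (Quotient.out_eq' (proj Γ z))
  obtain ⟨β, hβ⟩ := proj_eq_iff.1 (Quotient.out_eq' (proj Γ w))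
  have hinj : Function.Injective fun γ : Γ => γ • (proj Γ w).out := fun γ γ' h => by
    dsimp only at h
    have := hfree (γ'⁻¹ * γ) (proj Γ w).out (by rw [mul_smul, h, inv_smul_smul])
    exact (inv_mul_eq_one.1 this).symm
  have hs : Summable fun γ : Γ => K (proj Γ z).out (γ • (proj Γ w).out) :=
    summable_of_hasFiniteSupport ((hfin (proj Γ z).out).preimage hinj.injOn)
  -- Moving from the chosen representatives to `z` and `w` substitutes `α γ β⁻¹` for `γ`; invariance
  -- of `K` removes `α`.
  have := (((Equiv.mulLeft α).trans (Equiv.mulRight β⁻¹)).hasSum_iff).2 hs.hasSum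
  convert this using 1
  funext γ
  simp only [Function.comp_apply, Equiv.trans_apply, Equiv.coe_mulLeft, Equiv.coe_mulRight]
  rw [← hα, ← hβ, mul_smul, inv_smul_smul, mul_smul]
  exact (hK α _ _).symm

theorem tsum_sq_le_sq_tsum {α : Type*} (a : α → ℝ≥0∞) : ∑' i, a i ^ 2 ≤ (∑' i, a i) ^ 2 := by
  rw [sq (∑' i, a i), ← ENNReal.tsum_mul_right]
  refine ENNReal.tsum_le_tsum fun i => ?_
  rw [sq]
  exact mul_le_mul_right (ENNReal.le_tsum i) _

variable {K : Vertex F → Vertex F → ℂ} {Kbar : Y Γ → Y Γ → ℂ}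

theorem tsum_row_le_of_unique (hKbar : IsDescent Γ K Kbar)
    (hfree : ∀ (γ : Γ) (v : Vertex F), γ • v = v → γ = 1) {z : Vertex F}
    (huniq : ∀ w (γ γ' : Γ), K z (γ • w) ≠ 0 → K z (γ' • w) ≠ 0 → γ = γ') :
    ∑' y', ‖Kbar (proj Γ z) y'‖ₑ ^ 2 ≤ ∑' w, ‖K z w‖ₑ ^ 2 := by
  have hr : ∀ y : Y Γ, proj Γ y.out = y := fun y => Quotient.out_eq' y
  refine le_trans (ENNReal.tsum_le_tsum fun y' => ?_)
    (tsum_tsum_smul_rep_le hfree hr fun w => ‖K z w‖ₑ ^ 2)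
  have hsum := hKbar z y'.out
  rw [hr] at hsum
  by_cases h : ∃ γ : Γ, K z (γ • y'.out) ≠ 0
  · obtain ⟨γ, hγ⟩ := h
    have := hsum.unique (hasSum_single γ fun γ' hγ' => by
      by_contra hne
      exact hγ' (huniq _ _ _ hne hγ))
    rw [this]
    exact ENNReal.le_tsum γ
  · push Not at h
    simp_rw [h] at hsum
    rw [hsum.unique hasSum_zero]
    simp

theorem tsum_row_le_sq (hKbar : IsDescent Γ K Kbar)
    (hfree : ∀ (γ : Γ) (v : Vertex F), γ • v = v → γ = 1) (z : Vertex F) :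
    ∑' y', ‖Kbar (proj Γ z) y'‖ₑ ^ 2 ≤ (∑' w, ‖K z w‖ₑ) ^ 2 := by
  have hr : ∀ y : Y Γ, proj Γ y.out = y := fun y => Quotient.out_eq' y
  refine (tsum_sq_le_sq_tsum _).trans (pow_le_pow_left' ?_ 2)
  refine le_trans (ENNReal.tsum_le_tsum fun y' => ?_)
    (tsum_tsum_smul_rep_le hfree hr fun w => ‖K z w‖ₑ)
  have hsum := hKbar z y'.out
  rw [hr] at hsum
  rw [← hsum.tsum_eq]
  exact enorm_tsum_le_tsum_enorm

theorem tsum_enorm_le_encard_mul (K : Vertex F → Vertex F → ℂ) (z : Vertex F) :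
    ∑' w, ‖K z w‖ₑ ≤ ({w | K z w ≠ 0}.encard : ℝ≥0∞) * ⨆ (z) (w), ‖K z w‖ₑ := by
  have h : Function.support (fun w => ‖K z w‖ₑ) ⊆ {w | K z w ≠ 0} := fun w hw h0 =>
    hw (by simp [h0])
  rw [← tsum_subtype_eq_of_support_subset h, ← ENNReal.tsum_set_const]
  exact ENNReal.tsum_le_tsum fun w => le_iSup₂ (f := fun z w => ‖K z w‖ₑ) z w.1

end Descent
end Kernel7

/-! ### Assembly of the row bounds -/

open Kernel7 in
theorem mainTheorem7 {F : Type*} [Field F] [ValuativeRel F] [TopologicalSpace F]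
    [IsNonarchimedeanLocalField F] [CharZero F] (ϖ : Fˣ) (hϖ : Kernel7.IsUniformizer ϖ) :
    ∃ C₁ > (0 : ℝ), ∃ C₂ > (0 : ℝ),
      ∀ Γ : Subgroup (Kernel7.G F), Kernel7.IsLatticeIn Γ → Kernel7.IsTorsionFreeSubgroup Γ →
      ∀ D : Set (Kernel7.Vertex F), Kernel7.IsFundDomain Γ D →
      ∀ K : Kernel7.Vertex F → Kernel7.Vertex F → ℂ,
        (∀ (γ : Γ) (z w : Kernel7.Vertex F), K (γ • z) (γ • w) = K z w) →
      ∀ R : ℝ, 0 ≤ R →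
        (∀ z w : Kernel7.Vertex F, ENNReal.ofReal R ≤ Kernel7.vdist ϖ z w → K z w = 0) →
      ∃ Kbar : Kernel7.Y Γ → Kernel7.Y Γ → ℂ, Kernel7.IsDescent Γ K Kbar ∧
      ∃ T : Kernel7.L2 Γ →L[ℂ] Kernel7.L2 Γ, Kernel7.HasKernel T Kbar ∧
      ∀ (ι : Type*) (e : HilbertBasis ι ℂ (Kernel7.L2 Γ)),
        Kernel7.hsNormSq e T ≤
          (∑' (z : D) (w : Kernel7.Vertex F), ‖K z w‖ₑ ^ 2) +
          ENNReal.ofReal (C₁ * (Nat.card 𝓀[F] : ℝ) ^ (C₂ * R)) / Kernel7.injRad ϖ Γ ^ 2 *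
            (⨆ (z : Kernel7.Vertex F) (w : Kernel7.Vertex F), ‖K z w‖ₑ) ^ 2 *
            (Set.encard {y : Kernel7.Y Γ | Kernel7.injRadAt ϖ Γ y ≤ ENNReal.ofReal R} : ℝ≥0∞) := by
  have hq : 2 ≤ Nat.card 𝓀[F] := two_le_card_residueField
  have hq0 : (0 : ℝ) < Nat.card 𝓀[F] := by exact_mod_cast (by omega : 0 < Nat.card 𝓀[F])
  refine ⟨(Nat.card 𝓀[F] : ℝ) ^ 18, by positivity, 40, by norm_num, ?_⟩
  intro Γ hΓ hT D hD K hK R hR hsupp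
  have := hΓ.1
  have := finite_Y hΓ hT
  have hfree : ∀ (γ : Γ) (v : Vertex F), γ • v = v → γ = 1 := fun γ v h => eq_one_of_smul_eq hT h
  have hlt : ∀ z w, K z w ≠ 0 → vdist ϖ z w < ENNReal.ofReal R := fun z w h =>
    lt_of_not_ge fun h' => h (hsupp z w h')
  set N : ℕ := Nat.card 𝓀[F] ^ (9 * (⌊2 * R⌋₊ + 1)) with hN
  have hcard : ∀ z, {w | K z w ≠ 0}.encard ≤ (N : ℕ∞) := fun z =>
    (Set.encard_le_encard fun w hw => hlt z w hw).trans (encard_vdist_lt_le hϖ z R)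
  obtain ⟨Kbar, hKbar⟩ := exists_isDescent hK hfree fun z => Set.finite_of_encard_le_coe (hcard z)
  obtain ⟨T, hTK⟩ := exists_hasKernel Kbar
  refine ⟨Kbar, hKbar, T, hTK, fun ι e => (hsNormSq_le hTK e).trans ?_⟩
  set S : ℝ≥0∞ := ⨆ (z : Vertex F) (w : Vertex F), ‖K z w‖ₑ
  set bad : Set (Y Γ) := {y | injRadAt ϖ Γ y ≤ ENNReal.ofReal R}
  set c : ℝ≥0∞ := ENNReal.ofReal ((Nat.card 𝓀[F] : ℝ) ^ 18 * (Nat.card 𝓀[F] : ℝ) ^ (40 * R)) /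
    injRad ϖ Γ ^ 2
  choose r hr using fun y => (hD y).exists
  have hrow : ∀ y, ∑' y', ‖Kbar y y'‖ₑ ^ 2
      ≤ ∑' w, ‖K (r y) w‖ₑ ^ 2 + bad.indicator (fun _ => c * S ^ 2) y := by
    intro y
    by_cases hy : y ∈ bad
    · have hc : (N : ℝ≥0∞) ^ 2 ≤ c := by
        -- The positive finite numerator covers the degenerate values `0` and `∞` of `injRad`.
        rw [ENNReal.le_div_iff_mul_le (Or.inr (ENNReal.ofReal_pos.2 (by positivity)).ne') (Or.inr ENNReal.ofReal_ne_top)]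
        calc (N : ℝ≥0∞) ^ 2 * injRad ϖ Γ ^ 2 ≤ (N : ℝ≥0∞) ^ 2 * ENNReal.ofReal R ^ 2 := by
              gcongr
              exact (iInf_le _ y).trans hy
          _ = ENNReal.ofReal (R ^ 2 * (N : ℝ) ^ 2) := by
              rw [ENNReal.ofReal_mul (by positivity), ENNReal.ofReal_pow hR,
                ENNReal.ofReal_pow (by positivity), ENNReal.ofReal_natCast, mul_comm]
          _ ≤ _ := ENNReal.ofReal_le_ofReal (sq_mul_sq_card_ball_le hq hR)
      rw [Set.indicator_of_mem hy]
      refine le_add_left ?_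
      have h1 := tsum_row_le_sq hKbar hfree (r y)
      rw [(hr y).2] at h1
      refine h1.trans ?_
      calc (∑' w, ‖K (r y) w‖ₑ) ^ 2 ≤ ((N : ℝ≥0∞) * S) ^ 2 := by
            refine pow_le_pow_left' ((tsum_enorm_le_encard_mul K (r y)).trans ?_) 2
            gcongr
            exact_mod_cast ENat.toENNReal_mono (hcard (r y))
        _ ≤ c * S ^ 2 := by rw [mul_pow]; gcongr
    · refine le_add_right ?_
      have hy' : ENNReal.ofReal R < injRadAt ϖ Γ (proj Γ (r y)) := by
        rw [(hr y).2]; exact lt_of_not_ge hy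
      have h1 := tsum_row_le_of_unique hKbar hfree (z := r y) fun w γ γ' h h' => by
        have := eq_of_lt_injRadAt hy' (hlt _ _ h) (hlt _ _ h')
        have := hfree (γ'⁻¹ * γ) w (by rw [mul_smul, this, inv_smul_smul])
        exact (inv_mul_eq_one.1 this).symm
      rwa [(hr y).2] at h1
  refine (ENNReal.tsum_le_tsum hrow).trans ?_
  rw [ENNReal.tsum_add]
  refine add_le_add ?_ (le_of_eq ?_)
  -- Distinct points of `Y` have distinct representatives in `D`, so the rows of `K` used form part
  -- of the sum over `D`.
  · have hinj : Function.Injective fun y => (⟨r y, (hr y).1⟩ : D) := fun y y' h => by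
      rw [← (hr y).2, ← (hr y').2, show r y = r y' from congrArg Subtype.val h]
    exact ENNReal.tsum_comp_le_tsum_of_injective hinj fun z : D => ∑' w, ‖K z w‖ₑ ^ 2
  · rw [← tsum_subtype, ENNReal.tsum_set_const, mul_comm]
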